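/- Let $E$ be a Polish space with its Borel $\sigma$-algebra and let $\tilde d:E\times E\to[0,\infty)$ be measurable and symmetric, with $\tilde d(x,y)=0$ if and only if $x=y$ (for example $\tilde d(x,y)=\sqrt{d(x,y)(1+V(x)+V(y))}$ with $d$ symmetric, lower semicontinuous and zero exactly on the diagonal, and $V\ge 0$ measurable). For measures $\nu_1,\nu_2$ on $E$ put $$\tilde d(\nu_1,\nu_2)=\inf_{\pi\in\Gamma(\nu_1,\nu_2)}\int_{E\times E}\tilde d(x,y)\,\pi(dx,dy)\in[0,\infty],$$ where $\Gamma(\nu_1,\nu_2)$ is the set of measures on $E\times E$ with marginals $\nu_1$ and $\nu_2$. Let $\mathrm{Lip}(\tilde d)$ be the set of measurable $f:E\to\mathbb R$ for which there is $L<\infty$ with $|f(x)-f(y)|\le L\,\tilde d(x,y)$ for all $x,y\in E$. For a function $f\ge 0$, let $f\mu$ denote the measure with density $f$ with respect to $\mu$. Let $\mathcal P$ be a Markov kernel on $E$ which is reversible with respect to a probability measure $\mu$, write $(\mathcal P^n f)(x)=\int f(y)\,\mathcal P^n(x,dy)$ and $\mu(f)=\int f\,d\mu$, and suppose that $\mathrm{Lip}(\tilde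 d)\cap L^\infty_\mu$ is dense in $L^2_\mu$. Let $\lambda>0$, and suppose that for every $f\in\mathrm{Lip}(\tilde d)\cap L^\infty_\mu$ with $f\ge 0$ and $\mu(f)=1$ one has $\tilde d(f\mu,\mu)<\infty$ and there is a constant $C(f)<\infty$ such that $$\tilde d\big((\mathcal P^n f)\mu,\mu\big)\le C(f)\,e^{-\lambda n}\,\tilde d(f\mu,\mu)\qquad\text{for all } n\in\mathbb N.$$ Then for every $f\in L^2_\mu$ and every $n\in\mathbb N$ $$\|\mathcal P^n f-\mu(f)\|_2^2\le \|f-\mu(f)\|_2^2\,e^{-\lambda n}.$$ In particular $\mathcal P$ has an $L^2_\mu$-spectral gap, that is, $$\beta=\sup_{f\in L^2_\mu}\frac{\|\mathcal P f-\mu(f)\|_2}{\|f-\mu(f)\|_2}<1$$ (with the convention $0/0=0$). -/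

import Mathlib

open MeasureTheory ProbabilityTheory
open scoped NNReal ENNReal

noncomputable section

namespace WassersteinGap

/-- The cost functions `d̃ : E × E → [0, ∞)`: jointly measurable, symmetric and vanishing exactly on
the diagonal. Every lower semicontinuous distance-like function is of this kind, and so is
`d̃ (x, y) = √(d (x, y) (1 + V x + V y))` for such a `d` and a measurable `V ≥ 0`.
The triangle inequality is not required. -/
structure IsDistanceLike {E : Type*} [MeasurableSpace E] (d : E → E → ℝ≥0) : Prop where
  measurable : Measurable (Function.uncurry d)
  symm : ∀ x y, d x y = d y x
  eq_zero_iff : ∀ x y, d x y = 0 ↔ x = y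

/-- Couplings of `ν₁` and `ν₂`: measures on `E × E` with marginals `ν₁` and `ν₂`. -/
def couplings {E : Type*} [MeasurableSpace E] (ν₁ ν₂ : Measure E) : Set (Measure (E × E)) :=
  {π | π.map Prod.fst = ν₁ ∧ π.map Prod.snd = ν₂}

/-- The `1`-Wasserstein distance associated with `d`; it is `∞` if no coupling has finite cost. -/
def wasserstein {E : Type*} [MeasurableSpace E] (d : E → E → ℝ≥0) (ν₁ ν₂ : Measure E) : ℝ≥0∞ :=
  ⨅ π ∈ couplings ν₁ ν₂, ∫⁻ z, (d z.1 z.2 : ℝ≥0∞) ∂π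

/-- The action `(P f)(x) = ∫ f(y) P(x, dy)` of a kernel on functions. -/
def markovOp {E : Type*} [MeasurableSpace E] (P : Kernel E E) (f : E → ℝ) (x : E) : ℝ :=
  ∫ y, f y ∂(P x)

/-- The measure `f μ` with density `f ≥ 0` with respect to `μ`. -/
def densityMeasure {E : Type*} [MeasurableSpace E] (f : E → ℝ) (μ : Measure E) : Measure E :=
  μ.withDensity fun x => ENNReal.ofReal (f x)

/-- `f ∈ Lip(d) ∩ L^∞(μ)`. -/
structure IsLipBounded {E : Type*} [MeasurableSpace E] (d : E → E → ℝ≥0) (μ : Measure E)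
    (f : E → ℝ) : Prop where
  measurable : Measurable f
  lipschitz : ∃ L : ℝ≥0, ∀ x y, |f x - f y| ≤ L * d x y
  memLp_top : MemLp f ∞ μ

/-- `β = sup ‖P f - μ(f)‖₂ / ‖f - μ(f)‖₂` over `f ∈ L²(μ)`, the norm of `P` on the mean-zero part
of `L²(μ)` (with `0 / 0 = 0`). -/
def l2Beta {E : Type*} [MeasurableSpace E] (P : Kernel E E) (μ : Measure E) : ℝ≥0∞ :=
  ⨆ (f : E → ℝ) (_ : MemLp f 2 μ),
    eLpNorm (fun x => markovOp P f x - ∫ y, f y ∂μ) 2 μ / eLpNorm (fun x => f x - ∫ y, f y ∂μ) 2 μ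

/-- `P` has an `L²(μ)`-spectral gap (equal to `1 - β`). -/
def HasL2SpectralGap {E : Type*} [MeasurableSpace E] (P : Kernel E E) (μ : Measure E) : Prop :=
  l2Beta P μ < 1

end WassersteinGap

end

/-! Let `f` be a bounded Lipschitz density and `h = f - 1`. Since `μ` is invariant, `⟨h, Pⁿ h⟩ = ∫ f
d((Pⁿ f) μ) - μ(f)`, and testing a coupling against `f` itself bounds this by a Lipschitz constant
times the Wasserstein distance (`exists_autocorrelation_le`). So autocorrelations decay like `K
e^{-λ n}`, with `K` depending on `f`.

Reversibility removes `K`: `aₙ = ‖Pⁿ h‖² = ⟨h, P²ⁿ h⟩` satisfies `aₙ² ≤ a₂ₙ a₀` by Cauchy–Schwarz,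
so a bound `aₙ ≤ K rⁿ` improves to `aₙ ≤ a₀ rⁿ` (`le_mul_pow_of_sq_le`), here with `r = e^{-2λ}`.

A bounded Lipschitz function is an affine image of such a density, and the bound, now uniform in
`f`, extends by density because `P` contracts `L²(μ)`. -/

namespace WassersteinGap

variable {E : Type*} [MeasurableSpace E]

/-- Measurable functions that are bounded everywhere. -/
def BddMeas (f : E → ℝ) : Prop := Measurable f ∧ ∃ C, ∀ x, |f x| ≤ C

/-! ### Calculus of bounded measurable functions -/

namespace BddMeas

variable {f g : E → ℝ} {P Q : Kernel E E} {μ : Measure E}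

lemma const (c : ℝ) : BddMeas fun _ : E => c := ⟨measurable_const, |c|, fun _ => le_rfl⟩

lemma sub (hf : BddMeas f) (hg : BddMeas g) : BddMeas fun x => f x - g x := by
  obtain ⟨hf, A, hA⟩ := hf
  obtain ⟨hg, B, hB⟩ := hg
  exact ⟨hf.sub hg, A + B, fun x => (abs_sub _ _).trans (add_le_add (hA x) (hB x))⟩

lemma mul (hf : BddMeas f) (hg : BddMeas g) : BddMeas fun x => f x * g x := by
  obtain ⟨hf, A, hA⟩ := hf
  obtain ⟨hg, B, hB⟩ := hg
  refine ⟨hf.mul hg, A * B, fun x => ?_⟩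
  rw [abs_mul]
  exact mul_le_mul (hA x) (hB x) (abs_nonneg _) ((abs_nonneg _).trans (hA x))

lemma comp {F : Type*} [MeasurableSpace F] (hf : BddMeas f) {φ : F → E} (hφ : Measurable φ) :
    BddMeas fun x => f (φ x) :=
  ⟨hf.1.comp hφ, hf.2.choose, fun x => hf.2.choose_spec (φ x)⟩

lemma integrable (hf : BddMeas f) (ν : Measure E) [IsFiniteMeasure ν] : Integrable f ν := by
  obtain ⟨hf, C, hC⟩ := hf
  exact Integrable.of_bound hf.aestronglyMeasurable C (.of_forall hC)

lemma memLp (hf : BddMeas f) (p : ℝ≥0∞) (ν : Measure E) [IsFiniteMeasure ν] : MemLp f p ν := by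
  obtain ⟨hf, C, hC⟩ := hf
  exact MemLp.of_bound hf.aestronglyMeasurable C (.of_forall hC)

lemma markovOp [IsMarkovKernel P] (hf : BddMeas f) : BddMeas (markovOp P f) := by
  refine ⟨hf.1.stronglyMeasurable.integral_kernel.measurable, ?_⟩
  obtain ⟨-, C, hC⟩ := hf
  refine ⟨C, fun x => ?_⟩
  simpa [WassersteinGap.markovOp] using norm_integral_le_of_norm_le_const (μ := P x) (f := f) (C := C) (.of_forall hC)

lemma markovOp_comp [IsMarkovKernel P] [IsMarkovKernel Q] (hf : BddMeas f) :
    WassersteinGap.markovOp (Q ∘ₖ P) f =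
      WassersteinGap.markovOp P (WassersteinGap.markovOp Q f) := by
  funext x
  exact Kernel.integral_comp (hf.integrable _)

lemma markovOp_sub_const [IsMarkovKernel P] (hf : BddMeas f) (c : ℝ) :
    WassersteinGap.markovOp P (fun x => f x - c) =
      fun x => WassersteinGap.markovOp P f x - c := by
  funext x
  simp [WassersteinGap.markovOp, integral_sub (hf.integrable (P x)) (integrable_const c)]

lemma sq_integral_mul_le (hf : BddMeas f) (hg : BddMeas g) [IsFiniteMeasure μ] :
    (∫ x, f x * g x ∂μ) ^ 2 ≤ (∫ x, f x * f x ∂μ) * ∫ x, g x * g x ∂μ := by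
  -- The quadratic `∫ (f - t g)²` is nonnegative in `t`, so its discriminant is at most zero.
  have key : ∀ t : ℝ, 0 ≤ (∫ x, g x * g x ∂μ) * (t * t) + (-2 * ∫ x, f x * g x ∂μ) * t
      + ∫ x, f x * f x ∂μ := by
    intro t
    have h : ∫ x, (g x * g x * (t * t) + f x * g x * (-2 * t) + f x * f x) ∂μ
        = (∫ x, g x * g x ∂μ) * (t * t) + (∫ x, f x * g x ∂μ) * (-2 * t)
          + ∫ x, f x * f x ∂μ := by
      have h1 := ((hg.mul hg).integrable μ).mul_const (t * t)
      have h2 := ((hf.mul hg).integrable μ).mul_const (-2 * t)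
      rw [integral_add _ ((hf.mul hf).integrable μ), integral_add h1 h2,
        integral_mul_const, integral_mul_const]
      exact h1.add h2
    have h0 : 0 ≤ ∫ x, (g x * g x * (t * t) + f x * g x * (-2 * t) + f x * f x) ∂μ :=
      integral_nonneg fun x => by
        simp only [Pi.zero_apply]
        nlinarith [sq_nonneg (f x - t * g x)]
    linarith
  have := discrim_le_zero key
  rw [discrim] at this
  linarith

end BddMeas

/-! ### Self-adjointness and self-improving decay -/

section Reversible

variable {P : Kernel E E} {μ : Measure E} {f g : E → ℝ}

instance isMarkovKernel_pow [IsMarkovKernel P] (n : ℕ) : IsMarkovKernel (P ^ n) := by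
  induction n with
  | zero => rw [pow_zero]; exact inferInstanceAs (IsMarkovKernel Kernel.id)
  | succ n ih => rw [Kernel.pow_add, pow_one]; infer_instance

lemma markovOp_pow_add [IsMarkovKernel P] (hf : BddMeas f) (m n : ℕ) :
    markovOp (P ^ (m + n)) f = markovOp (P ^ m) (markovOp (P ^ n) f) := by
  rw [add_comm, Kernel.pow_add, hf.markovOp_comp]

lemma markovOp_pow_zero (hf : BddMeas f) : markovOp (P ^ 0) f = f := by
  funext x
  rw [pow_zero]
  change ∫ y, f y ∂(Kernel.id x) = f x
  rw [Kernel.id_apply, integral_dirac' _ _ hf.1.stronglyMeasurable]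

lemma invariant_pow (h : P.Invariant μ) (n : ℕ) : (P ^ n).Invariant μ := by
  induction n with
  | zero =>
    rw [pow_zero]
    exact Measure.bind_dirac
  | succ n ih =>
    rw [Kernel.pow_add, pow_one]
    exact ih.comp h

lemma _root_.ProbabilityTheory.Kernel.IsReversible.map_swap_compProd [IsMarkovKernel P]
    [IsFiniteMeasure μ] (h : P.IsReversible μ) : (μ ⊗ₘ P).map Prod.swap = μ ⊗ₘ P := by
  have : IsFiniteMeasure ((μ ⊗ₘ P).map Prod.swap) := Measure.isFiniteMeasure_map _ _
  refine Measure.ext_prod fun {s t} hs ht => ?_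
  rw [Measure.map_apply measurable_swap (hs.prod ht), Set.preimage_swap_prod,
    Measure.compProd_apply_prod ht hs, Measure.compProd_apply_prod hs ht]
  exact h ht hs

lemma integral_compProd_mul [IsMarkovKernel P] [IsFiniteMeasure μ] (hf : BddMeas f)
    (hg : BddMeas g) :
    ∫ z, f z.1 * g z.2 ∂(μ ⊗ₘ P) = ∫ x, f x * markovOp P g x ∂μ := by
  rw [Measure.integral_compProd
    (((hf.comp measurable_fst).mul (hg.comp measurable_snd)).integrable _)]
  simp only [integral_const_mul, markovOp]

/-- Both sides integrate against the joint law `μ ⊗ₘ P`, which is invariant under swapping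
coordinates. -/
lemma integral_mul_markovOp [IsMarkovKernel P] [IsFiniteMeasure μ] (h : P.IsReversible μ)
    (hf : BddMeas f) (hg : BddMeas g) :
    ∫ x, f x * markovOp P g x ∂μ = ∫ x, markovOp P f x * g x ∂μ := by
  rw [← integral_compProd_mul hf hg, ← h.map_swap_compProd, integral_map
    measurable_swap.aemeasurable
    ((hf.comp measurable_fst).mul (hg.comp measurable_snd)).1.aestronglyMeasurable]
  simp only [Prod.fst_swap, Prod.snd_swap]
  simp_rw [mul_comm (f _), integral_compProd_mul hg hf, mul_comm]

lemma integral_mul_markovOp_pow [IsMarkovKernel P] [IsFiniteMeasure μ] (h : P.IsReversible μ)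
    (n : ℕ) (hf : BddMeas f) (hg : BddMeas g) :
    ∫ x, f x * markovOp (P ^ n) g x ∂μ = ∫ x, markovOp (P ^ n) f x * g x ∂μ := by
  induction n generalizing f g with
  | zero => rw [markovOp_pow_zero hf, markovOp_pow_zero hg]
  | succ n ih =>
    rw [markovOp_pow_add hg, ih hf hg.markovOp, pow_one,
      integral_mul_markovOp h hf.markovOp hg, add_comm n 1, markovOp_pow_add hf, pow_one]

lemma integral_markovOp_sq [IsMarkovKernel P] [IsFiniteMeasure μ] (h : P.IsReversible μ)
    (n : ℕ) (hf : BddMeas f) :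
    ∫ x, markovOp (P ^ n) f x * markovOp (P ^ n) f x ∂μ
      = ∫ x, f x * markovOp (P ^ (2 * n)) f x ∂μ := by
  rw [two_mul, markovOp_pow_add hf, integral_mul_markovOp_pow h n hf hf.markovOp]

lemma integral_markovOp_pow [IsMarkovKernel P] [IsFiniteMeasure μ] (h : P.IsReversible μ)
    (n : ℕ) (hf : BddMeas f) : ∫ x, markovOp (P ^ n) f x ∂μ = ∫ x, f x ∂μ := by
  simpa [markovOp] using integral_mul_markovOp_pow h n (BddMeas.const 1) hf

/-- Geometric decay with an arbitrary constant improves to the constant `a 0` for sequences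
satisfying `a n ^ 2 ≤ a (2 * n) * a 0`. -/
lemma le_mul_pow_of_sq_le {a : ℕ → ℝ} {K r : ℝ} (ha : ∀ n, 0 ≤ a n) (hr : 0 < r)
    (hsq : ∀ n, a n ^ 2 ≤ a (2 * n) * a 0) (hK : ∀ n, a n ≤ K * r ^ n) (n : ℕ) :
    a n ≤ a 0 * r ^ n := by
  rcases (ha 0).eq_or_lt with h0 | h0
  · have := hsq n
    rw [← h0, mul_zero] at this
    rw [← h0, zero_mul, pow_eq_zero_iff two_ne_zero |>.1 (le_antisymm this (sq_nonneg _))]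
  set b : ℕ → ℝ := fun n => a n / (a 0 * r ^ n) with hb
  have hb0 : ∀ n, 0 ≤ b n := fun n => div_nonneg (ha n) (by positivity)
  have hb2 : ∀ n, b n ^ 2 ≤ b (2 * n) := by
    intro n
    simp only [hb]
    rw [div_pow, div_le_div_iff₀ (by positivity) (by positivity)]
    have := mul_le_mul_of_nonneg_right (hsq n) (by positivity : 0 ≤ a 0 * r ^ (2 * n))
    calc _ ≤ _ := this
      _ = _ := by ring
  have hbK : ∀ n, b n ≤ K / a 0 := by
    intro n
    simp only [hb]
    rw [div_le_div_iff₀ (by positivity) h0]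
    nlinarith [hK n, mul_le_mul_of_nonneg_right (hK n) h0.le]
  -- Iterated doubling: a value `b n > 1` would make `b` unbounded along `2 ^ k * n`, against `hbK`.
  have hpow : ∀ k, b n ^ 2 ^ k ≤ b (2 ^ k * n) := by
    intro k
    induction k with
    | zero => simp
    | succ k ih =>
      calc b n ^ 2 ^ (k + 1) = (b n ^ 2 ^ k) ^ 2 := by rw [← pow_mul, pow_succ]
        _ ≤ b (2 ^ k * n) ^ 2 := pow_le_pow_left₀ (pow_nonneg (hb0 n) _) ih 2
        _ ≤ b (2 * (2 ^ k * n)) := hb2 _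
        _ = b (2 ^ (k + 1) * n) := by rw [pow_succ]; ring_nf
  by_contra! hlt
  have h1 : 1 < b n := (one_lt_div (by positivity)).2 hlt
  obtain ⟨k, hk⟩ := pow_unbounded_of_one_lt (K / a 0) h1
  have h2 : b n ^ k ≤ b n ^ 2 ^ k := pow_le_pow_right₀ h1.le Nat.lt_two_pow_self.le
  linarith [hpow k, hbK (2 ^ k * n)]

/-- In `L²(μ)`, geometric decay of the autocorrelations of a reversible kernel at a rate `r`
forces decay at the same rate with constant one. -/
lemma integral_markovOp_sq_le [IsMarkovKernel P] [IsFiniteMeasure μ] (h : P.IsReversible μ)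
    (hf : BddMeas f) {K r : ℝ} (hr : 0 < r)
    (hK : ∀ n, ∫ x, f x * markovOp (P ^ (2 * n)) f x ∂μ ≤ K * r ^ n) (n : ℕ) :
    ∫ x, markovOp (P ^ n) f x * markovOp (P ^ n) f x ∂μ ≤ (∫ x, f x * f x ∂μ) * r ^ n := by
  have := le_mul_pow_of_sq_le
    (a := fun n => ∫ x, markovOp (P ^ n) f x * markovOp (P ^ n) f x ∂μ)
    (fun n => integral_nonneg fun x => mul_self_nonneg _) hr (fun n => ?_)
    (fun n => (integral_markovOp_sq h n hf).trans_le (hK n)) n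
  · simpa only [markovOp_pow_zero hf] using this
  · rw [integral_markovOp_sq h n hf, markovOp_pow_zero hf]
    exact (hf.sq_integral_mul_le hf.markovOp).trans_eq (mul_comm _ _)

end Reversible

/-! ### Easy half of Kantorovich duality -/

section Duality

variable {d : E → E → ℝ≥0} {f g : E → ℝ} {μ : Measure E}

/-- Integrate the Lipschitz bound over each coupling. `L ≠ 0` matters: without couplings the infimum
is `∞`, and `0 * ∞ = 0` would make the bound fail for constants and unequal masses. -/
lemma ofReal_integral_sub_le_wasserstein (hd : Measurable (Function.uncurry d)) (hf : BddMeas f)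
    {L : ℝ≥0} (hL0 : L ≠ 0) (hL : ∀ x y, |f x - f y| ≤ L * d x y) (ν₁ ν₂ : Measure E) [IsFiniteMeasure ν₁] :
    ENNReal.ofReal (∫ x, f x ∂ν₁ - ∫ x, f x ∂ν₂) ≤ L * wasserstein d ν₁ ν₂ := by
  have key : ∀ π ∈ couplings ν₁ ν₂, ENNReal.ofReal (∫ x, f x ∂ν₁ - ∫ x, f x ∂ν₂) ≤
      L * ∫⁻ z, (d z.1 z.2 : ℝ≥0∞) ∂π := by
    rintro π ⟨rfl, rfl⟩
    have : IsFiniteMeasure π := by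
      constructor
      have := measure_lt_top (π.map Prod.fst) Set.univ
      rwa [Measure.map_apply measurable_fst .univ, Set.preimage_univ] at this
    rw [integral_map measurable_fst.aemeasurable hf.1.aestronglyMeasurable,
      integral_map measurable_snd.aemeasurable hf.1.aestronglyMeasurable,
      ← integral_sub ((hf.comp measurable_fst).integrable π)
        ((hf.comp measurable_snd).integrable π), ← lintegral_const_mul]
    · refine (ENNReal.ofReal_le_ofReal (le_abs_self _)).trans ?_
      rw [← Real.norm_eq_abs, ofReal_norm]
      refine (enorm_integral_le_lintegral_enorm _).trans (lintegral_mono fun z => ?_)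
      rw [← ofReal_norm, Real.norm_eq_abs]
      refine (ENNReal.ofReal_le_ofReal (hL _ _)).trans_eq ?_
      rw [← NNReal.coe_mul, ENNReal.ofReal_coe_nnreal, ENNReal.coe_mul]
    · exact hd.coe_nnreal_ennreal
  rw [wasserstein]
  simp_rw [ENNReal.mul_iInf_of_ne (ENNReal.coe_ne_zero.2 hL0) ENNReal.coe_ne_top]
  exact le_iInf₂ key

end Duality

end WassersteinGap

/-! ### Markov operators on `L²(μ)` -/

namespace WassersteinGap

variable {E : Type*} [MeasurableSpace E]

lemma eLpNorm_two_sq (f : E → ℝ) (μ : Measure E) :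
    eLpNorm f 2 μ ^ 2 = ∫⁻ x, ‖f x‖ₑ ^ 2 ∂μ := by
  have := eLpNorm_nnreal_pow_eq_lintegral (f := f) (μ := μ) (p := 2) two_ne_zero
  simpa using! this

lemma BddMeas.eLpNorm_two_sq_eq {f : E → ℝ} (hf : BddMeas f) (μ : Measure E) [IsFiniteMeasure μ] :
    eLpNorm f 2 μ ^ 2 = ENNReal.ofReal (∫ x, f x * f x ∂μ) := by
  rw [eLpNorm_two_sq, ofReal_integral_eq_lintegral_ofReal ((hf.mul hf).integrable μ)
    (.of_forall fun x => mul_self_nonneg _)]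
  refine lintegral_congr fun x => ?_
  rw [← ofReal_norm, ← ENNReal.ofReal_pow (norm_nonneg _), Real.norm_eq_abs, sq_abs, sq]

section Contraction

variable {P : Kernel E E} {μ : Measure E} {f g : E → ℝ}

/-- Jensen's inequality under each `P x`, then invariance of `μ`. -/
lemma eLpNorm_markovOp_le [IsMarkovKernel P] (h : P.Invariant μ) (hf : AEStronglyMeasurable f μ) :
    eLpNorm (markovOp P f) 2 μ ≤ eLpNorm f 2 μ := by
  rw [← (ENNReal.pow_right_strictMono two_ne_zero).le_iff_le]
  rw [eLpNorm_two_sq]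
  have hf' : AEStronglyMeasurable f (μ.bind P) := by rwa [h.def]
  calc ∫⁻ x, ‖markovOp P f x‖ₑ ^ 2 ∂μ ≤ ∫⁻ x, ∫⁻ y, ‖f y‖ₑ ^ 2 ∂(P x) ∂μ := by
        refine lintegral_mono_ae ?_
        filter_upwards [Measure.ae_ae_of_ae_comp hf'.ae_eq_mk] with x hx
        have hfx : AEStronglyMeasurable f (P x) := ⟨_, hf'.stronglyMeasurable_mk, hx⟩
        rw [← eLpNorm_two_sq]
        refine pow_le_pow_left₀ zero_le ?_ 2
        refine (enorm_integral_le_lintegral_enorm _).trans ?_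
        rw [← eLpNorm_one_eq_lintegral_enorm]
        exact eLpNorm_le_eLpNorm_of_exponent_le one_le_two hfx
    _ = ∫⁻ y, ‖f y‖ₑ ^ 2 ∂(μ.bind P) :=
        (Measure.lintegral_bind P.aemeasurable (hf'.enorm.pow_const 2)).symm
    _ = eLpNorm f 2 μ ^ 2 := by rw [h.def, eLpNorm_two_sq]

/-- Makes `markovOp` additive almost everywhere: where `f` is not integrable the Bochner integral is
`0` by default. -/
lemma ae_integrable_of_invariant (h : P.Invariant μ) (hf : Integrable f μ) :
    ∀ᵐ x ∂μ, Integrable f (P x) := by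
  have hf' : AEStronglyMeasurable f (μ.bind P) := by rw [h.def]; exact hf.1
  have hfin : ∫⁻ x, ∫⁻ y, ‖f y‖ₑ ∂(P x) ∂μ ≠ ∞ := by
    rw [← Measure.lintegral_bind P.aemeasurable hf'.enorm, h.def]
    exact hf.2.ne
  have hm : AEMeasurable (fun x => ∫⁻ y, ‖f y‖ₑ ∂(P x)) μ := by
    refine ⟨fun x => ∫⁻ y, ‖hf'.mk f y‖ₑ ∂(P x),
      hf'.stronglyMeasurable_mk.enorm.lintegral_kernel, ?_⟩
    filter_upwards [Measure.ae_ae_of_ae_comp hf'.ae_eq_mk] with x hx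
    refine lintegral_congr_ae ?_
    filter_upwards [hx] with y hy
    rw [hy]
  filter_upwards [Measure.ae_ae_of_ae_comp hf'.ae_eq_mk, ae_lt_top' hm hfin] with x hx hx'
  exact ⟨⟨_, hf'.stronglyMeasurable_mk, hx⟩, hx'⟩

lemma aestronglyMeasurable_markovOp [IsMarkovKernel P] (h : P.Invariant μ)
    (hf : AEStronglyMeasurable f μ) : AEStronglyMeasurable (markovOp P f) μ := by
  have hf' : AEStronglyMeasurable f (μ.bind P) := by rwa [h.def]
  refine ⟨_, hf'.stronglyMeasurable_mk.integral_kernel (κ := P), ?_⟩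
  filter_upwards [Measure.ae_ae_of_ae_comp hf'.ae_eq_mk] with x hx
  exact integral_congr_ae hx

lemma markovOp_sub_ae (h : P.Invariant μ) (hf : Integrable f μ) (hg : Integrable g μ) :
    markovOp P (fun x => f x - g x) =ᵐ[μ] fun x => markovOp P f x - markovOp P g x := by
  filter_upwards [ae_integrable_of_invariant h hf, ae_integrable_of_invariant h hg] with x hx hx'
  exact integral_sub hx hx'

lemma eLpNorm_sub_integral_le [IsProbabilityMeasure μ] {u : E → ℝ}
    (hu : AEStronglyMeasurable u μ) (hf : AEStronglyMeasurable f μ) :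
    eLpNorm (fun x => u x - ∫ y, f y ∂μ) 2 μ ≤ eLpNorm u 2 μ + eLpNorm f 2 μ := by
  refine (eLpNorm_sub_le hu aestronglyMeasurable_const one_le_two).trans ?_
  gcongr
  rw [eLpNorm_const _ two_ne_zero (IsProbabilityMeasure.ne_zero μ)]
  simp only [measure_univ, ENNReal.one_rpow, mul_one]
  refine (enorm_integral_le_lintegral_enorm _).trans ?_
  rw [← eLpNorm_one_eq_lintegral_enorm]
  exact eLpNorm_le_eLpNorm_of_exponent_le one_le_two hf

/-- The bound `‖P f - μ(f)‖₂ ≤ c ‖f - μ(f)‖₂` passes to limits in `L²(μ)`. -/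
lemma eLpNorm_markovOp_sub_le_of_approx [IsMarkovKernel P] [IsProbabilityMeasure μ]
    (h : P.Invariant μ) {c : ℝ≥0∞} (hc : c ≠ ∞) (hf : MemLp f 2 μ)
    (happ : ∀ ε : ℝ≥0, 0 < ε → ∃ g : E → ℝ, MemLp g 2 μ ∧
      eLpNorm (fun x => f x - g x) 2 μ ≤ ε ∧
      eLpNorm (fun x => markovOp P g x - ∫ y, g y ∂μ) 2 μ ≤
        c * eLpNorm (fun x => g x - ∫ y, g y ∂μ) 2 μ) :
    eLpNorm (fun x => markovOp P f x - ∫ y, f y ∂μ) 2 μ ≤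
      c * eLpNorm (fun x => f x - ∫ y, f y ∂μ) 2 μ := by
  lift c to ℝ≥0 using hc
  refine ENNReal.le_of_forall_pos_le_add fun δ hδ _ => ?_
  -- The two centred error terms cost `2 ε` and `2 c ε`.
  set ε : ℝ≥0 := δ / (2 + 2 * c) with hε
  obtain ⟨g, hg, hfg, hgc⟩ := happ ε (by positivity)
  have hfi := hf.integrable one_le_two
  have hgi := hg.integrable one_le_two
  have hd : MemLp (fun x => f x - g x) 2 μ := hf.sub hg
  have hint : ∫ y, (f y - g y) ∂μ = ∫ y, f y ∂μ - ∫ y, g y ∂μ := integral_sub hfi hgi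
  have hPd := aestronglyMeasurable_markovOp h hd.1
  have hPg := aestronglyMeasurable_markovOp h hg.1
  have h1 : eLpNorm (fun x => markovOp P f x - ∫ y, f y ∂μ) 2 μ ≤
      eLpNorm (fun x => markovOp P (fun x => f x - g x) x - ∫ y, (f y - g y) ∂μ) 2 μ
        + eLpNorm (fun x => markovOp P g x - ∫ y, g y ∂μ) 2 μ := by
    refine le_trans (le_of_eq (eLpNorm_congr_ae ?_))
      (eLpNorm_add_le (hPd.sub aestronglyMeasurable_const)
        (hPg.sub aestronglyMeasurable_const) one_le_two)
    filter_upwards [markovOp_sub_ae h hfi hgi] with x hx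
    simp only [Pi.add_apply, hx, hint]
    ring
  have h2 : eLpNorm (fun x => g x - ∫ y, g y ∂μ) 2 μ ≤
      eLpNorm (fun x => f x - ∫ y, f y ∂μ) 2 μ
        + eLpNorm (fun x => (f x - g x) - ∫ y, (f y - g y) ∂μ) 2 μ := by
    refine le_trans (le_of_eq (congrArg (eLpNorm · 2 μ) ?_))
      (eLpNorm_sub_le (hf.1.sub aestronglyMeasurable_const)
        (hd.1.sub aestronglyMeasurable_const) one_le_two)
    funext x
    simp only [Pi.sub_apply, hint]
    ring
  have h3 := (eLpNorm_sub_integral_le (μ := μ) hPd hd.1).trans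
    (add_le_add (eLpNorm_markovOp_le h hd.1) le_rfl)
  have h4 := eLpNorm_sub_integral_le (μ := μ) hd.1 hd.1
  calc _ ≤ _ := h1
    _ ≤ (ε + ε) + c * (eLpNorm (fun x => f x - ∫ y, f y ∂μ) 2 μ + (ε + ε)) := by
        gcongr
        · exact h3.trans (add_le_add hfg hfg)
        · refine hgc.trans ?_
          gcongr
          refine h2.trans ?_
          gcongr
          exact h4.trans (add_le_add hfg hfg)
    _ = c * eLpNorm (fun x => f x - ∫ y, f y ∂μ) 2 μ + ((2 + 2 * c) * ε : ℝ≥0) := by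
        push_cast
        ring
    _ = c * eLpNorm (fun x => f x - ∫ y, f y ∂μ) 2 μ + δ := by
        rw [hε, mul_div_cancel₀ _ (by positivity)]

end Contraction

/-! ### From Wasserstein decay to autocorrelations -/

section Decay

variable {d : E → E → ℝ≥0} {P : Kernel E E} {μ : Measure E} {f : E → ℝ}

/-- Truncating at the essential supremum preserves the Lipschitz bound and changes `f` only on a
null set, giving a representative bounded everywhere. -/
lemma IsLipBounded.exists_clamp (hf : IsLipBounded d μ f) :
    ∃ M : ℝ, 0 ≤ M ∧ IsLipBounded d μ (fun x => max (-M) (min (f x) M)) ∧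
      (fun x => max (-M) (min (f x) M)) =ᵐ[μ] f := by
  obtain ⟨hm, ⟨L, hL⟩, htop⟩ := hf
  have hfin : eLpNormEssSup f μ ≠ ∞ := by
    simpa using htop.2.ne
  have hae : (fun x => max (-(eLpNormEssSup f μ).toReal)
      (min (f x) (eLpNormEssSup f μ).toReal)) =ᵐ[μ] f := by
    filter_upwards [enorm_ae_le_eLpNormEssSup f μ] with x hx
    have : |f x| ≤ (eLpNormEssSup f μ).toReal := by
      have := ENNReal.toReal_mono hfin hx
      rwa [toReal_enorm] at this
    rw [min_eq_left (abs_le.1 this).2, max_eq_right (abs_le.1 this).1]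
  refine ⟨_, ENNReal.toReal_nonneg, ⟨measurable_const.max (hm.min measurable_const),
    ⟨L, fun x y => ?_⟩, (memLp_congr_ae hae).2 htop⟩, hae⟩
  refine le_trans ?_ (hL x y)
  refine (abs_max_sub_max_le_max _ _ _ _).trans ?_
  rw [sub_self, abs_zero]
  refine max_le (abs_nonneg _) ((abs_min_sub_min_le_max _ _ _ _).trans ?_)
  rw [sub_self, abs_zero]
  exact max_le le_rfl (abs_nonneg _)

lemma IsLipBounded.affine (hf : IsLipBounded d μ f) [IsFiniteMeasure μ] (a b : ℝ) :
    IsLipBounded d μ (fun x => a * (f x + b)) := by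
  obtain ⟨hm, ⟨L, hL⟩, htop⟩ := hf
  refine ⟨(hm.add_const b).const_mul a, ⟨‖a‖₊ * L, fun x y => ?_⟩,
    (htop.add (memLp_const b)).const_mul a⟩
  have : a * (f x + b) - a * (f y + b) = a * (f x - f y) := by ring
  rw [this, abs_mul, NNReal.coe_mul, coe_nnnorm, Real.norm_eq_abs, mul_assoc]
  exact mul_le_mul_of_nonneg_left (hL x y) (abs_nonneg _)

lemma integral_densityMeasure {g : E → ℝ} (hg : Measurable g) (hg0 : ∀ x, 0 ≤ g x) :
    ∫ x, f x ∂(densityMeasure g μ) = ∫ x, g x * f x ∂μ := by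
  rw [densityMeasure, integral_withDensity_eq_integral_toReal_smul hg.ennreal_ofReal
    (.of_forall fun _ => ENNReal.ofReal_lt_top)]
  simp [ENNReal.toReal_ofReal (hg0 _)]

lemma isFiniteMeasure_densityMeasure (hf : Integrable f μ) :
    IsFiniteMeasure (densityMeasure f μ) :=
  isFiniteMeasure_withDensity_ofReal hf.2

lemma markovOp_nonneg (hf : ∀ x, 0 ≤ f x) (x : E) : 0 ≤ markovOp P f x :=
  integral_nonneg hf

/-- Exponential decay of the Wasserstein distance bounds the autocorrelations of a Lipschitz
probability density. -/
lemma exists_autocorrelation_le [IsMarkovKernel P] [IsProbabilityMeasure μ]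
    (hrev : P.IsReversible μ) (hd : Measurable (Function.uncurry d)) {lam : ℝ}
    (hbdd : BddMeas f) (hf : IsLipBounded d μ f) (hf0 : ∀ x, 0 ≤ f x) (hf1 : ∫ x, f x ∂μ = 1)
    (hW : wasserstein d (densityMeasure f μ) μ < ∞) {C : ℝ≥0}
    (hC : ∀ n : ℕ, wasserstein d (densityMeasure (markovOp (P ^ n) f) μ) μ ≤
      C * ENNReal.ofReal (Real.exp (-lam * n)) * wasserstein d (densityMeasure f μ) μ) :
    ∃ K : ℝ, ∀ n : ℕ, ∫ x, (f x - 1) * markovOp (P ^ n) (fun x => f x - 1) x ∂μ ≤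
      K * Real.exp (-lam * n) := by
  obtain ⟨L, hL⟩ := hf.lipschitz
  lift wasserstein d (densityMeasure f μ) μ to ℝ≥0 using hW.ne with W
  -- `L + 1` replaces `L` to keep the Lipschitz constant nonzero in the duality bound.
  refine ⟨(L + 1) * (C * W), fun n => ?_⟩
  have hP : BddMeas (markovOp (P ^ n) f) := hbdd.markovOp
  have := isFiniteMeasure_densityMeasure (hP.integrable μ)
  have hdual := ofReal_integral_sub_le_wasserstein hd hbdd (L := L + 1) (by positivity)
    (fun x y => (hL x y).trans (by push_cast; gcongr; linarith))
    (densityMeasure (markovOp (P ^ n) f) μ) μ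
  rw [integral_densityMeasure hP.1 (markovOp_nonneg hf0)] at hdual
  have heq : ∫ x, (f x - 1) * markovOp (P ^ n) (fun x => f x - 1) x ∂μ =
      ∫ x, markovOp (P ^ n) f x * f x ∂μ - ∫ x, f x ∂μ := by
    rw [hbdd.markovOp_sub_const]
    have h1 : ∀ x, (f x - 1) * (markovOp (P ^ n) f x - 1) =
        (markovOp (P ^ n) f x * f x - f x) - (markovOp (P ^ n) f x - 1) := fun x => by ring
    simp_rw [h1]
    rw [integral_sub (((hP.mul hbdd).sub hbdd).integrable μ)
      ((hP.sub (BddMeas.const 1)).integrable μ),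
      integral_sub ((hP.mul hbdd).integrable μ) (hbdd.integrable μ),
      integral_sub (hP.integrable μ) (integrable_const 1), integral_markovOp_pow hrev n hbdd, hf1]
    simp
  rw [heq]
  have hle := hdual.trans (mul_le_mul_right (hC n) _)
  have hr : (((L + 1 : ℝ≥0) : ℝ≥0∞) * (C * ENNReal.ofReal (Real.exp (-lam * n)) * W)) =
      ENNReal.ofReal ((L + 1) * (C * W) * Real.exp (-lam * n)) := by
    rw [ENNReal.ofReal_mul (by positivity), ENNReal.ofReal_mul (by positivity),
      ENNReal.ofReal_mul (by positivity), ENNReal.ofReal_coe_nnreal, ENNReal.ofReal_coe_nnreal,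
      ← NNReal.coe_one, ← NNReal.coe_add, ENNReal.ofReal_coe_nnreal]
    ring
  rw [hr] at hle
  exact (ENNReal.ofReal_le_ofReal_iff (by positivity)).1 hle

end Decay

end WassersteinGap

/-! ### Contraction for Lipschitz functions, then by density -/

namespace WassersteinGap

section Main

variable {E : Type*} [MeasurableSpace E] {d : E → E → ℝ≥0} {P : Kernel E E} {μ : Measure E}
  {g : E → ℝ}

/-- `f ↦ d̃((Pⁿ f) μ, μ)` decays at the rate `e^{-λ n}` along every density in
`Lip(d̃) ∩ L^∞(μ)`. -/
def WassersteinDecay (d : E → E → ℝ≥0) (P : Kernel E E) (μ : Measure E) (lam : ℝ) : Prop :=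
  ∀ f : E → ℝ, IsLipBounded d μ f → (∀ x, 0 ≤ f x) → ∫ x, f x ∂μ = 1 →
    wasserstein d (densityMeasure f μ) μ < ∞ ∧
    ∃ C : ℝ≥0, ∀ n : ℕ, wasserstein d (densityMeasure (markovOp (P ^ n) f) μ) μ ≤
      C * ENNReal.ofReal (Real.exp (-lam * n)) * wasserstein d (densityMeasure f μ) μ

lemma eLpNorm_markovOp_pow_sub_le_of_isLipBounded [IsMarkovKernel P] [IsProbabilityMeasure μ]
    (hrev : P.IsReversible μ) (hd : Measurable (Function.uncurry d)) {lam : ℝ}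
    (hdecay : WassersteinDecay d P μ lam) {M : ℝ} (hM : ∀ x, |g x| ≤ M)
    (hg : IsLipBounded d μ g) (n : ℕ) :
    eLpNorm (fun x => markovOp (P ^ n) g x - ∫ y, g y ∂μ) 2 μ ≤
      ENNReal.ofReal (Real.exp (-lam * n)) * eLpNorm (fun x => g x - ∫ y, g y ∂μ) 2 μ := by
  have hgb : BddMeas g := ⟨hg.measurable, M, hM⟩
  -- Shifting by `M + 1` makes `g` at least `1`, so its mean `m` is positive and division by `m`
  -- yields a density.
  set m : ℝ := ∫ y, g y ∂μ + (M + 1) with hm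
  have hgM : ∀ x, 1 ≤ g x + (M + 1) := fun x => by linarith [(abs_le.1 (hM x)).1]
  have hint : ∫ x, (g x + (M + 1)) ∂μ = m := by
    rw [integral_add (hgb.integrable μ) (integrable_const _)]
    simp [hm]
  have hm1 : 1 ≤ m := by
    rw [← hint]
    have := integral_mono (integrable_const 1)
      ((hgb.integrable μ).add (integrable_const (M + 1))) (μ := μ) hgM
    simpa using this
  have hm0 : m ≠ 0 := by positivity
  have hf := hg.affine m⁻¹ (M + 1)
  have hf0 : ∀ x, 0 ≤ m⁻¹ * (g x + (M + 1)) := fun x =>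
    mul_nonneg (by positivity) (zero_le_one.trans (hgM x))
  have hf1 : ∫ x, m⁻¹ * (g x + (M + 1)) ∂μ = 1 := by
    rw [integral_const_mul, hint, inv_mul_cancel₀ hm0]
  have hfb : BddMeas fun x => m⁻¹ * (g x + (M + 1)) := by
    simpa only [sub_neg_eq_add] using
      (BddMeas.const m⁻¹).mul (hgb.sub (BddMeas.const (-(M + 1))))
  obtain ⟨hW, C, hC⟩ := hdecay _ hf hf0 hf1
  obtain ⟨K, hK⟩ := exists_autocorrelation_le hrev hd hfb hf hf0 hf1 hW hC
  have hh : ∀ x, g x - ∫ y, g y ∂μ = m * (m⁻¹ * (g x + (M + 1)) - 1) := fun x => by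
    rw [mul_sub, mul_inv_cancel_left₀ hm0, hm]
    ring
  have hhb : BddMeas fun x => g x - ∫ y, g y ∂μ := hgb.sub (BddMeas.const _)
  -- The squared rate comes from `‖Pᵏ h‖² = ⟨h, P²ᵏ h⟩`: autocorrelations are used at time `2 * k`.
  have hdec := integral_markovOp_sq_le hrev hhb (K := m ^ 2 * K) (r := Real.exp (-lam) ^ 2)
    (by positivity) (fun k => ?_) n
  · rw [← (ENNReal.pow_right_strictMono two_ne_zero).le_iff_le]
    rw [mul_pow, hhb.eLpNorm_two_sq_eq,
      ((hgb.markovOp (P := P ^ n)).sub (BddMeas.const _)).eLpNorm_two_sq_eq,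
      ← ENNReal.ofReal_pow (Real.exp_nonneg _), ← ENNReal.ofReal_mul (by positivity)]
    refine ENNReal.ofReal_le_ofReal ?_
    rw [hgb.markovOp_sub_const] at hdec
    refine hdec.trans_eq ?_
    rw [mul_comm (-lam), Real.exp_nat_mul, ← pow_mul, ← pow_mul, mul_comm 2 n, mul_comm]
  · have hmul : ∀ x, (g x - ∫ y, g y ∂μ) * markovOp (P ^ (2 * k)) (fun x => g x - ∫ y, g y ∂μ) x =
        m ^ 2 * ((m⁻¹ * (g x + (M + 1)) - 1) *
          markovOp (P ^ (2 * k)) (fun x => m⁻¹ * (g x + (M + 1)) - 1) x) := fun x => by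
      simp_rw [hh, markovOp, integral_const_mul]
      ring
    simp_rw [hmul]
    rw [integral_const_mul, mul_assoc]
    refine mul_le_mul_of_nonneg_left ((hK (2 * k)).trans_eq ?_) (by positivity)
    rw [mul_comm (-lam), Real.exp_nat_mul, pow_mul]

lemma eLpNorm_markovOp_pow_sub_le [IsMarkovKernel P] [IsProbabilityMeasure μ]
    (hrev : P.IsReversible μ) (hd : Measurable (Function.uncurry d))
    (hdense : Dense {g : Lp ℝ 2 μ | ∃ f : E → ℝ, IsLipBounded d μ f ∧ g =ᵐ[μ] f}) {lam : ℝ}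
    (hdecay : WassersteinDecay d P μ lam) {f : E → ℝ} (hf : MemLp f 2 μ) (n : ℕ) :
    eLpNorm (fun x => markovOp (P ^ n) f x - ∫ y, f y ∂μ) 2 μ ≤
      ENNReal.ofReal (Real.exp (-lam * n)) * eLpNorm (fun x => f x - ∫ y, f y ∂μ) 2 μ := by
  refine eLpNorm_markovOp_sub_le_of_approx (invariant_pow hrev.invariant n)
    ENNReal.ofReal_ne_top hf fun ε hε => ?_
  obtain ⟨u, ⟨v, hv, huv⟩, hu⟩ := Metric.dense_iff.1 hdense hf.toLp ε hε |>.imp fun _ h => h.symm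
  obtain ⟨M, hM0, hclamp, hae⟩ := hv.exists_clamp
  have hM : ∀ x, |max (-M) (min (v x) M)| ≤ M := fun x =>
    abs_le.2 ⟨le_max_left _ _, max_le (by linarith) (min_le_right _ _)⟩
  refine ⟨_, BddMeas.memLp ⟨hclamp.measurable, M, hM⟩ 2 μ, ?_,
    eLpNorm_markovOp_pow_sub_le_of_isLipBounded hrev hd hdecay hM hclamp n⟩
  have hed : edist hf.toLp u ≤ ε := by
    rw [edist_comm, edist_nndist]
    exact_mod_cast (Metric.mem_ball.1 hu).le
  rw [Lp.edist_def] at hed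
  refine (eLpNorm_congr_ae ?_).trans_le hed
  filter_upwards [hf.coeFn_toLp, huv, hae] with x h1 h2 h3
  rw [h3, Pi.sub_apply, h1, h2]

end Main

end WassersteinGap

theorem proposition2p2 {E : Type*} [TopologicalSpace E] [PolishSpace E] [MeasurableSpace E]
    [BorelSpace E] (d : E → E → ℝ≥0) (hd : WassersteinGap.IsDistanceLike d)
    (P : Kernel E E) [IsMarkovKernel P] (μ : Measure E) [IsProbabilityMeasure μ]
    (hrev : P.IsReversible μ)
    (hdense : Dense {g : Lp ℝ 2 μ | ∃ f : E → ℝ, WassersteinGap.IsLipBounded d μ f ∧ g =ᵐ[μ] f})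
    (lam : ℝ) (hlam : 0 < lam)
    (hdecay : ∀ f : E → ℝ, WassersteinGap.IsLipBounded d μ f → (∀ x, 0 ≤ f x) → ∫ x, f x ∂μ = 1 →
      WassersteinGap.wasserstein d (WassersteinGap.densityMeasure f μ) μ < ∞ ∧
      ∃ C : ℝ≥0, ∀ n : ℕ,
        WassersteinGap.wasserstein d
            (WassersteinGap.densityMeasure (WassersteinGap.markovOp (P ^ n) f) μ) μ ≤
          C * ENNReal.ofReal (Real.exp (-lam * n)) *
            WassersteinGap.wasserstein d (WassersteinGap.densityMeasure f μ) μ) :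
    (∀ f : E → ℝ, MemLp f 2 μ → ∀ n : ℕ,
      eLpNorm (fun x => WassersteinGap.markovOp (P ^ n) f x - ∫ y, f y ∂μ) 2 μ ^ 2 ≤
        eLpNorm (fun x => f x - ∫ y, f y ∂μ) 2 μ ^ 2 * ENNReal.ofReal (Real.exp (-lam * n))) ∧
    WassersteinGap.HasL2SpectralGap P μ := by
  have hL2 : ∀ f : E → ℝ, MemLp f 2 μ → ∀ n : ℕ,
      eLpNorm (fun x => WassersteinGap.markovOp (P ^ n) f x - ∫ y, f y ∂μ) 2 μ ≤
        ENNReal.ofReal (Real.exp (-lam * n)) * eLpNorm (fun x => f x - ∫ y, f y ∂μ) 2 μ :=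
    fun f hf n =>
      WassersteinGap.eLpNorm_markovOp_pow_sub_le hrev hd.measurable hdense hdecay hf n
  refine ⟨fun f hf n => ?_, ?_⟩
  · have hexp : Real.exp (-lam * n) ≤ 1 := Real.exp_le_one_iff.2
      (mul_nonpos_of_nonpos_of_nonneg (by linarith) n.cast_nonneg)
    -- Squaring gives the stronger factor `e^{-2λ n}`, then weakened to `e^{-λ n}`.
    calc _ ≤ _ := pow_le_pow_left₀ zero_le (hL2 f hf n) 2
      _ ≤ _ := by
        rw [mul_pow, mul_comm]
        gcongr
        exact pow_le_of_le_one zero_le (ENNReal.ofReal_le_one.2 hexp) two_ne_zero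
  · have hlt : ENNReal.ofReal (Real.exp (-lam)) < 1 :=
      ENNReal.ofReal_lt_one.2 (Real.exp_lt_one_iff.2 (by linarith))
    refine lt_of_le_of_lt (iSup₂_le fun f hf => ENNReal.div_le_of_le_mul ?_) hlt
    simpa using hL2 f hf 1
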